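/- **Calculus.** Terms of the untyped probabilistic $\lambda$-calculus are $M ::= x \mid \lambda x.M \mid MM \mid M\oplus M \mid \Omega$, taken up to renaming of bound variables. The affine judgement $\Gamma\vdash M$, with $\Gamma$ a finite set of variables, is given by the rules: $\Gamma,x\vdash x$; $\Gamma\vdash\Omega$; if $\Gamma,x\vdash M$ then $\Gamma\vdash\lambda x.M$; if $\Gamma\vdash M$, $\Delta\vdash N$ and $\Gamma\cap\Delta=\emptyset$ then $\Gamma\cup\Delta\vdash MN$; if $\Gamma\vdash M$ and $\Gamma\vdash N$ then $\Gamma\vdash M\oplus N$. A *program* is a term $M$ with $\emptyset\vdash M$, and a *value* is a program of the form $\lambda x.M$. **Semantics.** The call-by-value evaluation relation $M\Downarrow\mathscr D$ between programs and value subdistributions is defined inductively: $\Omega\Downarrow 0$; $V\Downarrow\delta_V$ (the Dirac distribution) for a value $V$; if $M\Downarrow\mathscr D$ and $N\Downarrow\mathscr E$ then $M\oplus N\Downarrow\frac12\mathscr D+\frac12\mathscr E$; if $M\Downarrow\mathscr D$, $N\Downarrow\mathscr E$, and $L\{V/x\}\Downarrow\mathscr F_{L,V}$ for all $\lambda x.L\in\mathrm{supp}(\mathscr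 D)$ and $V\in\mathrm{supp}(\mathscr E)$, then $MN\Downarrow\sum_{\lambda x.L,\,V}\mathscr D(\lambda x.L)\,\mathscr E(V)\,\mathscr F_{L,V}$. For every program $M$ there is exactly one $\mathscr D$ with $M\Downarrow\mathscr D$; it is finitely supported and is written $[\![M]\!]$. **Trace distance.** A *trace* is a finite (possibly empty) sequence $s=V_1\cdots V_n$ of values. The probability $\Pr(M,s)$ that a program $M$ accepts $s$ is defined by $\Pr(\lambda x.M,\epsilon)=1$, $\Pr(\lambda x.M,V\cdot s)=\Pr(M\{V/x\},s)$, and $\Pr(M,s)=\sum_V[\![M]\!](V)\,\Pr(V,s)$ if $M$ is not a value. The *trace distance* between programs $M$ and $N$ is $\delta^{\mathrm{tr}}(M,N)=\sup_s|\Pr(M,s)-\Pr(N,s)|$, the supremum being over all traces $s$. **Contexts.** Contexts are $\mathcal C ::= [\cdot]\mid M\mid\lambda x.\mathcal C\mid\mathcal C M\mid M\mathcal C\mid\mathcal C\oplus\mathcal C$, where $M$ ranges over terms. The judgement $\Gamma\vdash\mathcal C$ is defined by $\Gamma\vdash[\cdot]$ for every $\Gamma$ together with the same rules as for terms. An *affine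 context* is a context $\mathcal C$ with $\emptyset\vdash\mathcal C$, and $\mathcal C[M]$ is the program obtained by replacing the hole $[\cdot]$ by the program $M$. **Theorem.** The trace distance is non-expansive: for all programs $M$ and $N$ and every affine context $\mathcal C$, $$\delta^{\mathrm{tr}}(\mathcal C[M],\mathcal C[N])\;\le\;\delta^{\mathrm{tr}}(M,N).$$ -/

import Mathlib

namespace AffineLambda

/-! ### Terms and the affine discipline -/

/-- Terms of the untyped probabilistic lambda-calculus with an explicit divergent term, up to
renaming of bound variables (de Bruijn indices): `choice M N` is the fair choice `M ⊕ N`, and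
`omega` is the divergent term. -/
inductive Term : Type
  | var : ℕ → Term
  | lam : Term → Term
  | app : Term → Term → Term
  | choice : Term → Term → Term
  | omega : Term

/-- The affine judgement `Γ ⊢ M`, where `Γ` is a finite set of variables. Below a binder the bound
variable is `0` and the variables of `Γ` are shifted by one. -/
inductive Term.Affine : Finset ℕ → Term → Prop
  | var {Γ : Finset ℕ} {n : ℕ} : n ∈ Γ → Term.Affine Γ (Term.var n)
  | lam {Γ : Finset ℕ} {M : Term} :
      Term.Affine (insert 0 (Γ.image Nat.succ)) M → Term.Affine Γ (Term.lam M)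
  | app {Γ Δ : Finset ℕ} {M N : Term} : Disjoint Γ Δ →
      Term.Affine Γ M → Term.Affine Δ N → Term.Affine (Γ ∪ Δ) (Term.app M N)
  | choice {Γ : Finset ℕ} {M N : Term} :
      Term.Affine Γ M → Term.Affine Γ N → Term.Affine Γ (Term.choice M N)
  | omega {Γ : Finset ℕ} : Term.Affine Γ Term.omega

/-- Substitution of the *closed* term `V` for the variable `k` (the variables above `k` go down by
one, since the binder of `k` disappears). As `V` is closed, it is not shifted below binders. -/
def Term.subst (V : Term) : ℕ → Term → Term
  | k, .var n => if n = k then V else if k < n then .var (n - 1) else .var n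
  | k, .lam M => .lam (Term.subst V (k + 1) M)
  | k, .app M N => .app (Term.subst V k M) (Term.subst V k N)
  | k, .choice M N => .choice (Term.subst V k M) (Term.subst V k N)
  | _, .omega => .omega

theorem Term.Affine.mono {Γ : Finset ℕ} {M : Term} (h : M.Affine Γ) :
    ∀ {Δ : Finset ℕ}, Γ ⊆ Δ → M.Affine Δ := by
  induction h with
  | var hn => intro Δ hΔ; exact .var (hΔ hn)
  | lam _ ih =>
    intro Δ hΔ
    exact .lam (ih (Finset.insert_subset_insert _ (Finset.image_subset_image hΔ)))
  | @app Γ₁ Γ₂ M N hd _ _ ihM ihN =>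
    intro Δ hΔ
    have h1 : Γ₁ ⊆ Δ \ Γ₂ := by
      intro a ha
      rw [Finset.mem_sdiff]
      exact ⟨hΔ (Finset.mem_union_left _ ha), Finset.disjoint_left.1 hd ha⟩
    have h2 : Γ₂ ⊆ Δ := fun a ha => hΔ (Finset.mem_union_right _ ha)
    have h3 := Term.Affine.app (Finset.sdiff_disjoint) (ihM h1) (ihN (Finset.Subset.refl Γ₂))
    rwa [Finset.sdiff_union_of_subset h2] at h3
  | choice _ _ ihM ihN => intro Δ hΔ; exact .choice (ihM hΔ) (ihN hΔ)
  | omega => intro Δ _; exact .omega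

/-- Effect of substituting for the variable `k` on the name of a variable other than `k`. -/
def dropVar (k n : ℕ) : ℕ := if k < n then n - 1 else n

theorem Term.Affine.subst {Γ : Finset ℕ} {M V : Term} (h : M.Affine Γ) (hV : V.Affine ∅) :
    ∀ k : ℕ, (Term.subst V k M).Affine ((Γ.erase k).image (dropVar k)) := by
  induction h with
  | @var Γ n hn =>
    intro k
    by_cases hk : n = k
    · simp only [Term.subst, hk, if_true]
      exact hV.mono (Finset.empty_subset _)
    · have : Term.subst V k (.var n) = .var (dropVar k n) := by
        simp only [Term.subst, dropVar, hk, if_false]; split_ifs <;> rfl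
      rw [this]
      exact .var (Finset.mem_image_of_mem _ (Finset.mem_erase.2 ⟨hk, hn⟩))
  | @lam Γ M _ ih =>
    intro k
    refine .lam ((ih (k + 1)).mono ?_)
    intro a ha
    simp only [Finset.mem_image, Finset.mem_erase, Finset.mem_insert] at ha ⊢
    obtain ⟨b, ⟨hb, rfl | ⟨c, hc, rfl⟩⟩, rfl⟩ := ha
    · left; simp [dropVar]
    · right
      refine ⟨dropVar k c, ⟨c, ⟨fun e => hb (by simp [e]), hc⟩, rfl⟩, ?_⟩
      simp only [dropVar]; split_ifs <;> omega
  | @app Γ₁ Γ₂ M N hd _ _ ihM ihN =>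
    intro k
    rw [Finset.erase_union_distrib, Finset.image_union]
    refine .app ?_ (ihM k) (ihN k)
    rw [Finset.disjoint_left]
    intro a h1 h2
    simp only [Finset.mem_image, Finset.mem_erase] at h1 h2
    obtain ⟨b, ⟨hb, hb1⟩, rfl⟩ := h1
    obtain ⟨c, ⟨hc, hc1⟩, e⟩ := h2
    have : c = b := by
      simp only [dropVar] at e; split_ifs at e <;> omega
    exact Finset.disjoint_left.1 hd hb1 (this ▸ hc1)
  | choice _ _ ihM ihN => intro k; exact .choice (ihM k) (ihN k)
  | omega => intro k; exact .omega

/-! ### Programs and values -/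

/-- A program is a closed affine term. -/
abbrev Program : Type := {M : Term // M.Affine ∅}

/-- A value is a program of the form `λx. body`. -/
@[ext] structure Value : Type where
  body : Term
  affine : body.Affine {0}

namespace Program

def omega : Program := ⟨.omega, .omega⟩

def choice (M N : Program) : Program := ⟨.choice M.1 N.1, .choice M.2 N.2⟩

def app (M N : Program) : Program :=
  ⟨.app M.1 N.1, by simpa using Term.Affine.app (Finset.disjoint_empty_left ∅) M.2 N.2⟩

end Program

namespace Value

/-- The program `λx. body`. -/
def toProgram (V : Value) : Program := ⟨.lam V.body, .lam (by simpa using V.affine)⟩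

/-- For `U = λx. L`, the program `L{V/x}`. -/
def apply (U V : Value) : Program :=
  ⟨Term.subst V.toProgram.1 0 U.body, by
    have h := U.affine.subst V.toProgram.2 0
    simpa using h⟩

theorem toProgram_injective : Function.Injective toProgram := by
  intro U V h
  have := congrArg Subtype.val h
  simp only [toProgram, Term.lam.injEq] at this
  exact Value.ext this

end Value

def Program.IsValue (M : Program) : Prop := ∃ V : Value, V.toProgram = M

/-! ### Big-step semantics -/

/-- Big-step evaluation `M ⇓ D` of a program to a (finitely supported) value subdistribution. -/
inductive BigStep : Program → (Value →₀ ℝ) → Prop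
  | omega : BigStep Program.omega 0
  | value (V : Value) : BigStep V.toProgram (Finsupp.single V 1)
  | choice {M N : Program} {D E : Value →₀ ℝ} : BigStep M D → BigStep N E →
      BigStep (Program.choice M N) ((1 / 2 : ℝ) • D + (1 / 2 : ℝ) • E)
  | app {M N : Program} {D E : Value →₀ ℝ} (F : Value → Value → (Value →₀ ℝ)) :
      BigStep M D → BigStep N E →
      (∀ U ∈ D.support, ∀ V ∈ E.support, BigStep (U.apply V) (F U V)) →
      BigStep (Program.app M N)
        (∑ U ∈ D.support, ∑ V ∈ E.support, (D U * E V) • F U V)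

/-- Every distribution obtained by evaluation is nonnegative and has weight at most one. -/
theorem BigStep.subdistribution {M : Program} {D : Value →₀ ℝ} (h : BigStep M D) :
    (∀ V, 0 ≤ D V) ∧ ∑ V ∈ D.support, D V ≤ 1 := by
  suffices H : (∀ V, 0 ≤ D V) ∧ D.sum (fun _ p => p) ≤ 1 from H
  have hadd : ∀ D E : Value →₀ ℝ, (D + E).sum (fun _ p => p)
      = D.sum (fun _ p => p) + E.sum (fun _ p => p) := fun D E =>
    Finsupp.sum_add_index' (fun _ => rfl) (fun _ _ _ => rfl)
  have hsmul : ∀ (c : ℝ) (D : Value →₀ ℝ), (c • D).sum (fun _ p => p)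
      = c * D.sum (fun _ p => p) := fun c D => by
    rw [Finsupp.sum_smul_index (fun _ => rfl)]
    simp only [Finsupp.sum, Finset.mul_sum]
  let w : (Value →₀ ℝ) →+ ℝ :=
    { toFun := fun D => D.sum (fun _ p => p), map_zero' := Finsupp.sum_zero_index, map_add' := hadd }
  have hw : ∀ D, w D = D.sum (fun _ p => p) := fun _ => rfl
  induction h with
  | omega => simp
  | value V =>
    classical
    refine ⟨fun W => ?_, by simp⟩
    rw [Finsupp.single_apply]; split_ifs <;> norm_num
  | @choice M N D E _ _ ihD ihE =>
    refine ⟨fun V => ?_, ?_⟩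
    · have h1 := ihD.1 V
      have h2 := ihE.1 V
      simp only [Finsupp.add_apply, Finsupp.smul_apply, smul_eq_mul]
      positivity
    · rw [hadd, hsmul, hsmul]
      linarith [ihD.2, ihE.2]
  | @app M N D E F _ _ _ ihD ihE ihF =>
    refine ⟨fun W => ?_, ?_⟩
    · simp only [Finsupp.finsetSum_apply, Finsupp.smul_apply, smul_eq_mul]
      exact Finset.sum_nonneg fun U hU => Finset.sum_nonneg fun V hV =>
        mul_nonneg (mul_nonneg (ihD.1 U) (ihE.1 V)) ((ihF U hU V hV).1 W)
    · rw [← hw, map_sum]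
      calc ∑ U ∈ D.support, w (∑ V ∈ E.support, (D U * E V) • F U V)
          ≤ ∑ U ∈ D.support, D U := by
            refine Finset.sum_le_sum fun U hU => ?_
            rw [map_sum]
            calc ∑ V ∈ E.support, w ((D U * E V) • F U V)
                ≤ ∑ V ∈ E.support, D U * E V := by
                  refine Finset.sum_le_sum fun V hV => ?_
                  rw [hw, hsmul]
                  exact mul_le_of_le_one_right (mul_nonneg (ihD.1 U) (ihE.1 V)) (ihF U hU V hV).2
              _ = D U * E.sum (fun _ p => p) := by rw [Finsupp.sum, Finset.mul_sum]
              _ ≤ D U := mul_le_of_le_one_right (ihD.1 U) ihE.2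
        _ ≤ 1 := ihD.2

theorem BigStep.unique {M : Program} {D : Value →₀ ℝ} (h : BigStep M D) :
    ∀ {D' : Value →₀ ℝ}, BigStep M D' → D' = D := by
  induction h with
  | omega =>
    intro D' h'
    generalize hP : Program.omega = P at h'
    cases h' <;> first | rfl | (have := congrArg Subtype.val hP; cases this)
  | value V =>
    intro D' h'
    generalize hP : V.toProgram = P at h'
    cases h' with
    | value W => rw [Value.toProgram_injective hP]
    | omega => have := congrArg Subtype.val hP; cases this
    | choice _ _ => have := congrArg Subtype.val hP; cases this
    | app _ _ _ _ => have := congrArg Subtype.val hP; cases this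
  | @choice M N D E _ _ ihD ihE =>
    intro D' h'
    generalize hP : Program.choice M N = P at h'
    cases h' with
    | @choice M' N' D₁ E₁ h1 h2 =>
      have hv := congrArg Subtype.val hP
      simp only [Program.choice, Term.choice.injEq] at hv
      obtain rfl := Subtype.ext hv.1
      obtain rfl := Subtype.ext hv.2
      rw [ihD h1, ihE h2]
    | omega => have := congrArg Subtype.val hP; cases this
    | value _ => have := congrArg Subtype.val hP; cases this
    | app _ _ _ _ => have := congrArg Subtype.val hP; cases this
  | @app M N D E F _ _ _ ihD ihE ihF =>
    intro D' h'
    generalize hP : Program.app M N = P at h'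
    cases h' with
    | @app M' N' D₁ E₁ F₁ h1 h2 h3 =>
      have hv := congrArg Subtype.val hP
      simp only [Program.app, Term.app.injEq] at hv
      obtain rfl := Subtype.ext hv.1
      obtain rfl := Subtype.ext hv.2
      obtain rfl := ihD h1
      obtain rfl := ihE h2
      refine Finset.sum_congr rfl fun U hU => Finset.sum_congr rfl fun V hV => ?_
      rw [ihF U hU V hV (h3 U hU V hV)]
    | omega => have := congrArg Subtype.val hP; cases this
    | value _ => have := congrArg Subtype.val hP; cases this
    | choice _ _ => have := congrArg Subtype.val hP; cases this

def Term.size : Term → ℕ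
  | .var _ => 1
  | .lam M => M.size + 1
  | .app M N => M.size + N.size + 1
  | .choice M N => max M.size N.size + 1
  | .omega => 1

theorem Term.Affine.size_subst {Γ : Finset ℕ} {M : Term} (V : Term) (h : M.Affine Γ) :
    ∀ k : ℕ, (Term.subst V k M).size ≤ M.size + (if k ∈ Γ then V.size else 0) := by
  induction h with
  | @var Γ n hn =>
    intro k
    by_cases hk : n = k
    · subst hk; simp [Term.subst, hn]
    · simp only [Term.subst, hk, if_false]; split_ifs <;> simp [Term.size]
  | @lam Γ M _ ih =>
    intro k
    have := ih (k + 1)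
    simp only [Finset.mem_insert, Finset.mem_image, Nat.succ_eq_add_one, Nat.add_right_cancel_iff,
      exists_eq_right, Nat.add_eq_zero_iff, one_ne_zero, and_false, false_or] at this
    simp only [Term.subst, Term.size]; omega
  | @app Γ₁ Γ₂ M N hd _ _ ihM ihN =>
    intro k
    have h1 := ihM k
    have h2 := ihN k
    have h3 : ¬ (k ∈ Γ₁ ∧ k ∈ Γ₂) := fun h => Finset.disjoint_left.1 hd h.1 h.2
    simp only [Term.subst, Term.size, Finset.mem_union]
    by_cases hk1 : k ∈ Γ₁ <;> by_cases hk2 : k ∈ Γ₂ <;> simp_all <;> omega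
  | choice _ _ ihM ihN =>
    intro k
    have h1 := ihM k
    have h2 := ihN k
    simp only [Term.subst, Term.size]; omega
  | omega => intro k; simp [Term.subst, Term.size]

theorem exists_bigStep (n : ℕ) : ∀ M : Program, M.1.size ≤ n →
    ∃ D, BigStep M D ∧ ∀ V ∈ D.support, V.toProgram.1.size ≤ M.1.size := by
  induction n with
  | zero => rintro ⟨M, hM⟩ h; cases M <;> simp [Term.size] at h
  | succ n ih =>
    rintro ⟨M, hM⟩ hn
    cases M with
    | var i =>
      exfalso
      clear hn
      generalize hΓ : (∅ : Finset ℕ) = Γ at hM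
      cases hM with | var h => subst hΓ; simp at h
    | omega => exact ⟨0, .omega, by simp⟩
    | lam L =>
      have hL : L.Affine {0} := by
        generalize hΓ : (∅ : Finset ℕ) = Γ at hM
        cases hM with | lam h => subst hΓ; simpa using h
      refine ⟨_, .value ⟨L, hL⟩, fun V hV => ?_⟩
      have : V = ⟨L, hL⟩ := by
        classical
        exact Finset.mem_singleton.1 (Finsupp.support_single_subset hV)
      subst this; exact le_rfl
    | choice M N =>
      have hMN : M.Affine ∅ ∧ N.Affine ∅ := by
        generalize hΓ : (∅ : Finset ℕ) = Γ at hM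
        cases hM with | choice h1 h2 => subst hΓ; exact ⟨h1, h2⟩
      simp only [Term.size] at hn
      obtain ⟨D, hD, sD⟩ := ih ⟨M, hMN.1⟩ (by simp only; omega)
      obtain ⟨E, hE, sE⟩ := ih ⟨N, hMN.2⟩ (by simp only; omega)
      refine ⟨_, .choice hD hE, fun V hV => ?_⟩
      simp only [Term.size]
      by_cases h1 : V ∈ D.support
      · have := sD V h1; simp only at this; omega
      · by_cases h2 : V ∈ E.support
        · have := sE V h2; simp only at this; omega
        · simp only [Finsupp.mem_support_iff, not_not] at h1 h2
          simp [h1, h2] at hV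
    | app M N =>
      have hMN : M.Affine ∅ ∧ N.Affine ∅ := by
        generalize hΓ : (∅ : Finset ℕ) = Γ at hM
        cases hM with
        | app _ h1 h2 =>
          obtain ⟨e1, e2⟩ := Finset.union_eq_empty.1 hΓ.symm
          subst e1; subst e2; exact ⟨h1, h2⟩
      simp only [Term.size] at hn
      obtain ⟨D, hD, sD⟩ := ih ⟨M, hMN.1⟩ (by simp only; omega)
      obtain ⟨E, hE, sE⟩ := ih ⟨N, hMN.2⟩ (by simp only; omega)
      have key : ∀ U ∈ D.support, ∀ V ∈ E.support, (U.apply V).1.size ≤ M.size + N.size := by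
        intro U hU V hV
        have h1 := sD U hU
        have h2 := sE V hV
        have h3 := U.affine.size_subst V.toProgram.1 0
        simp only [Value.apply, Finset.mem_singleton, if_true] at h3 ⊢
        simp only [Value.toProgram, Term.size] at h1 h2 h3 ⊢
        omega
      have hF : ∀ U V, ∃ F : Value →₀ ℝ, U ∈ D.support → V ∈ E.support →
          BigStep (U.apply V) F ∧ ∀ W ∈ F.support, W.toProgram.1.size ≤ M.size + N.size := by
        intro U V
        by_cases h : U ∈ D.support ∧ V ∈ E.support
        · have hk := key U h.1 V h.2
          obtain ⟨F, hF, sF⟩ := ih (U.apply V) (by omega)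
          exact ⟨F, fun _ _ => ⟨hF, fun W hW => (sF W hW).trans hk⟩⟩
        · exact ⟨0, fun h1 h2 => absurd ⟨h1, h2⟩ h⟩
      choose F hF using hF
      refine ⟨_, .app F hD hE fun U hU V hV => (hF U V hU hV).1, fun W hW => ?_⟩
      simp only [Term.size]
      by_contra hlt
      refine Finsupp.mem_support_iff.1 hW ?_
      simp only [Finsupp.finsetSum_apply, Finsupp.smul_apply, smul_eq_mul]
      refine Finset.sum_eq_zero fun U hU => Finset.sum_eq_zero fun V hV => ?_
      have : F U V W = 0 := by
        by_contra hne
        have := (hF U V hU hV).2 W (Finsupp.mem_support_iff.2 hne)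
        omega
      rw [this, mul_zero]

/-- Every program evaluates to exactly one value distribution. -/
theorem existsUnique_bigStep (M : Program) : ∃! D, BigStep M D := by
  obtain ⟨D, hD, _⟩ := exists_bigStep _ M le_rfl
  exact ⟨D, hD, fun D' h' => hD.unique h'⟩

/-- The semantics `⟦M⟧` of a program: the unique value distribution to which it evaluates. -/
noncomputable def sem (M : Program) : Value →₀ ℝ := (existsUnique_bigStep M).choose

theorem sem_spec (M : Program) : BigStep M (sem M) := (existsUnique_bigStep M).choose_spec.1

/-! ### Traces and the trace distance -/

/-- A trace is a finite sequence of values, the arguments passed one after the other. -/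
abbrev Trace : Type := List Value

open Classical in
/-- The probability that a program accepts a trace. -/
noncomputable def prob (M : Program) (s : Trace) : ℝ :=
  if hM : M.IsValue then
    match s with
    | [] => 1
    | V :: t => prob (hM.choose.apply V) t
  else ∑ V ∈ (sem M).support, sem M V * prob V.toProgram s
termination_by (s.length, if M.IsValue then 0 else 1)
decreasing_by
  · left; simp
  · have hV : V.toProgram.IsValue := ⟨V, rfl⟩
    simp only [hM, hV, if_true, if_false]
    exact Prod.Lex.right _ Nat.zero_lt_one

theorem prob_value_nil (U : Value) : prob U.toProgram [] = 1 := by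
  have hU : U.toProgram.IsValue := ⟨U, rfl⟩
  rw [prob, dif_pos hU]

theorem prob_value_cons (U V : Value) (s : Trace) :
    prob U.toProgram (V :: s) = prob (U.apply V) s := by
  have hU : U.toProgram.IsValue := ⟨U, rfl⟩
  rw [prob, dif_pos hU]
  simp only [Value.toProgram_injective hU.choose_spec]

theorem prob_of_not_isValue {M : Program} (hM : ¬ M.IsValue) (s : Trace) :
    prob M s = ∑ V ∈ (sem M).support, sem M V * prob V.toProgram s := by
  rw [prob, dif_neg hM]

/-- Acceptance probabilities lie in `[0, 1]`, so that the supremum below is a genuine one. -/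
theorem prob_mem_Icc (M : Program) (s : Trace) : prob M s ∈ Set.Icc (0 : ℝ) 1 := by
  induction s generalizing M with
  | nil =>
    by_cases hM : M.IsValue
    · obtain ⟨U, rfl⟩ := hM
      rw [prob_value_nil]; norm_num
    · have h := (sem_spec M).subdistribution
      rw [prob_of_not_isValue hM]
      simp only [prob_value_nil, mul_one]
      exact ⟨Finset.sum_nonneg fun V _ => h.1 V, h.2⟩
  | cons W s ih =>
    by_cases hM : M.IsValue
    · obtain ⟨U, rfl⟩ := hM
      rw [prob_value_cons]; exact ih _
    · have h := (sem_spec M).subdistribution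
      rw [prob_of_not_isValue hM]
      simp only [prob_value_cons]
      exact ⟨Finset.sum_nonneg fun V _ => mul_nonneg (h.1 V) (ih _).1,
        (Finset.sum_le_sum fun V _ => mul_le_of_le_one_right (h.1 V) (ih _).2).trans h.2⟩

/-- The trace distance. -/
noncomputable def traceDist (M N : Program) : ℝ := ⨆ s : Trace, |prob M s - prob N s|

/-! ### Contexts -/

/-- Contexts: `C ::= [·] | M | λx.C | C M | M C | C ⊕ C`. -/
inductive RawCtx : Type
  | hole : RawCtx
  | term : Term → RawCtx
  | lam : RawCtx → RawCtx
  | appLeft : RawCtx → Term → RawCtx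
  | appRight : Term → RawCtx → RawCtx
  | choice : RawCtx → RawCtx → RawCtx

/-- The affine judgement for contexts. -/
inductive RawCtx.Affine : Finset ℕ → RawCtx → Prop
  | hole {Γ : Finset ℕ} : RawCtx.Affine Γ RawCtx.hole
  | term {Γ : Finset ℕ} {M : Term} : M.Affine Γ → RawCtx.Affine Γ (RawCtx.term M)
  | lam {Γ : Finset ℕ} {C : RawCtx} :
      RawCtx.Affine (insert 0 (Γ.image Nat.succ)) C → RawCtx.Affine Γ (RawCtx.lam C)
  | appLeft {Γ Δ : Finset ℕ} {C : RawCtx} {M : Term} : Disjoint Γ Δ →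
      RawCtx.Affine Γ C → M.Affine Δ → RawCtx.Affine (Γ ∪ Δ) (RawCtx.appLeft C M)
  | appRight {Γ Δ : Finset ℕ} {M : Term} {C : RawCtx} : Disjoint Γ Δ →
      M.Affine Γ → RawCtx.Affine Δ C → RawCtx.Affine (Γ ∪ Δ) (RawCtx.appRight M C)
  | choice {Γ : Finset ℕ} {C C' : RawCtx} :
      RawCtx.Affine Γ C → RawCtx.Affine Γ C' → RawCtx.Affine Γ (RawCtx.choice C C')

/-- Replacement of the hole by a closed term. -/
def RawCtx.fill : RawCtx → Term → Term
  | .hole, P => P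
  | .term M, _ => M
  | .lam C, P => .lam (C.fill P)
  | .appLeft C M, P => .app (C.fill P) M
  | .appRight M C, P => .app M (C.fill P)
  | .choice C C', P => .choice (C.fill P) (C'.fill P)

theorem RawCtx.Affine.fill {Γ : Finset ℕ} {C : RawCtx} (h : C.Affine Γ) {P : Term}
    (hP : P.Affine ∅) : (C.fill P).Affine Γ := by
  induction h with
  | hole => exact hP.mono (Finset.empty_subset _)
  | term h => exact h
  | lam _ ih => exact .lam ih
  | appLeft hd _ hM ih => exact .app hd ih hM
  | appRight hd hM _ ih => exact .app hd hM ih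
  | choice _ _ ih ih' => exact .choice ih ih'

/-- An affine context without free variables: its filling with a program is a program. -/
abbrev Ctx : Type := {C : RawCtx // C.Affine ∅}

/-- The program `C[M]`. -/
def Ctx.fill (C : Ctx) (M : Program) : Program := ⟨C.1.fill M.1, C.2.fill M.2⟩

end AffineLambda

/-!
A *test of size `n`* is a convex combination of `0`, `1` and the functions `M ↦ Pr(M, t)`, where
the values of the trace `t` have total size at most `n`. Tests do not expand the trace distance,
so it suffices that `M ↦ Pr(C[M], s)` is a test of size `|C| + |s|`, where `|C|` is the size of
`C[Ω]`. This goes by induction on `|C| + |s|`.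

* `Pr(C[M] L, s)` is the expectation of `Pr(C[M], V · s)` over the values `V` of `L`, and
  `|V| ≤ |L|`.
* `Pr((λx.C)[M], V · s) = Pr(C{V/x}[M], s)`, and `|C{V/x}| ≤ |C| + |V|` because `x` occurs at most
  once on each branch of a choice.
* `Pr(L C[M], s)` is the expectation of `Pr(A{V/x}, s)` over the values `λx.A` of `L` and `V` of
  `C[M]`. By affinity `A{V/x}` is a context `D` with `|D| ≤ |L|` filled with `V`, so `Pr(D[V], s)`
  is a test of `V` of size `|D| + |s|`. Its expectation over the values `V` of `C[M]` is a
  combination of numbers `Pr(C[M], t)` with `|t| ≤ |D| + |s|`.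
-/

namespace AffineLambda

theorem BigStep.sem_eq {M : Program} {D : Value →₀ ℝ} (h : BigStep M D) : sem M = D :=
  h.unique (sem_spec M)

theorem size_le_of_mem_support_sem {M : Program} {V : Value} (hV : V ∈ (sem M).support) :
    V.toProgram.1.size ≤ M.1.size := by
  obtain ⟨D, hD, hsize⟩ := exists_bigStep _ M le_rfl
  exact hsize V (hD.sem_eq ▸ hV)

/-- The expectation of a function on values under the semantics of a program, as a linear function
of the former. -/
noncomputable def expect : (Value → ℝ) →ₗ[ℝ] (Program → ℝ) :=
  LinearMap.pi fun M => ∑ V ∈ (sem M).support, sem M V • LinearMap.proj V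

theorem expect_apply (g : Value → ℝ) (M : Program) :
    expect g M = ∑ V ∈ (sem M).support, sem M V * g V := by
  simp [expect]

theorem expect_eq_linearCombination (g : Value → ℝ) (M : Program) :
    expect g M = Finsupp.linearCombination ℝ g (sem M) :=
  expect_apply g M

theorem expect_comm (f : Value → Value → ℝ) (M N : Program) :
    expect (fun U => expect (f U) N) M = expect (fun V => expect (fun U => f U V) M) N := by
  simp only [expect_apply, Finset.mul_sum]
  rw [Finset.sum_comm]
  simp only [mul_left_comm]

theorem expect_toProgram (g : Value → ℝ) (V : Value) : expect g V.toProgram = g V := by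
  simp [expect_eq_linearCombination, (BigStep.value V).sem_eq]

theorem expect_choice (g : Value → ℝ) (M N : Program) :
    expect g (M.choice N) = (1 / 2 : ℝ) • expect g M + (1 / 2 : ℝ) • expect g N := by
  simp only [expect_eq_linearCombination, (BigStep.choice (sem_spec M) (sem_spec N)).sem_eq,
    map_add, map_smul]

theorem expect_app (g : Value → ℝ) (M N : Program) :
    expect g (M.app N) = expect (fun U => expect (fun V => expect g (U.apply V)) N) M := by
  have hsem := (BigStep.app (fun U V => sem (U.apply V)) (sem_spec M) (sem_spec N)
    fun U _ V _ => sem_spec (U.apply V)).sem_eq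
  rw [expect_eq_linearCombination, hsem]
  simp only [map_sum, map_smul, smul_eq_mul, ← expect_eq_linearCombination, expect_apply _ M,
    expect_apply _ N, Finset.mul_sum, mul_assoc]

theorem prob_eq_expect (M : Program) (s : Trace) :
    prob M s = expect (fun V => prob V.toProgram s) M := by
  by_cases hM : M.IsValue
  · obtain ⟨U, rfl⟩ := hM
    rw [expect_toProgram]
  · rw [prob_of_not_isValue hM, expect_apply]

theorem prob_choice (M N : Program) (s : Trace) :
    prob (M.choice N) s = (1 / 2 : ℝ) • prob M s + (1 / 2 : ℝ) • prob N s := by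
  rw [prob_eq_expect, expect_choice, ← prob_eq_expect, ← prob_eq_expect]

theorem prob_app (M N : Program) (s : Trace) :
    prob (M.app N) s = expect (fun U => expect (fun V => prob (U.apply V) s) N) M := by
  simp only [prob_eq_expect (M.app N), expect_app, ← prob_eq_expect]

theorem prob_app_eq_expect_cons (M N : Program) (s : Trace) :
    prob (M.app N) s = expect (fun V => prob M (V :: s)) N := by
  simp only [prob_app, prob_eq_expect M, prob_value_cons]
  exact expect_comm _ M N

theorem abs_prob_sub_prob_le_traceDist (M N : Program) (s : Trace) :
    |prob M s - prob N s| ≤ traceDist M N := by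
  refine le_ciSup (f := fun s : Trace => |prob M s - prob N s|) ⟨1, ?_⟩ s
  rintro _ ⟨t, rfl⟩
  exact Real.dist_le_of_mem_Icc_01 (prob_mem_Icc M t) (prob_mem_Icc N t)

theorem traceDist_nonneg (M N : Program) : 0 ≤ traceDist M N :=
  Real.iSup_nonneg fun _ => abs_nonneg _

/-- The total size of the values of a trace. -/
def Trace.size (s : Trace) : ℕ := (s.map fun V => V.toProgram.1.size).sum

theorem Trace.size_cons (V : Value) (s : Trace) :
    Trace.size (V :: s) = V.toProgram.1.size + s.size := by
  simp [Trace.size]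

/-- The tests of size `n`: convex combinations of `0`, `1` and the acceptance probabilities of the
traces of size at most `n`. -/
def tests (n : ℕ) : Set (Program → ℝ) :=
  convexHull ℝ ({0, 1} ∪ (fun s M => prob M s) '' {s : Trace | s.size ≤ n})

section Tests

variable {m n : ℕ} {f : Program → ℝ} {s : Trace}

theorem tests_mono (hmn : m ≤ n) : tests m ⊆ tests n :=
  convexHull_mono <| Set.union_subset_union_right _ <| Set.image_mono fun _ hs => le_trans hs hmn

theorem convex_tests (n : ℕ) : Convex ℝ (tests n) := convex_convexHull _ _

theorem zero_mem_tests (n : ℕ) : (0 : Program → ℝ) ∈ tests n :=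
  subset_convexHull _ _ (by simp)

theorem one_mem_tests (n : ℕ) : (1 : Program → ℝ) ∈ tests n :=
  subset_convexHull _ _ (by simp)

theorem prob_mem_tests (hs : s.size ≤ n) : (fun M => prob M s) ∈ tests n :=
  subset_convexHull _ _ (Or.inr ⟨s, hs, rfl⟩)

theorem tests_subset {S : Set (Program → ℝ)} (hS : Convex ℝ S) (zero_mem : 0 ∈ S) (one_mem : 1 ∈ S)
    (prob_mem : ∀ s : Trace, s.size ≤ n → (fun M => prob M s) ∈ S) : tests n ⊆ S := by
  refine convexHull_min ?_ hS
  rintro _ ((rfl | rfl) | ⟨s, hs, rfl⟩)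
  exacts [zero_mem, one_mem, prob_mem s hs]

theorem const_mem_tests {c : ℝ} (hc : c ∈ Set.Icc (0 : ℝ) 1) : (fun _ => c) ∈ tests n := by
  convert (convex_tests n).smul_mem_of_zero_mem (zero_mem_tests n) (one_mem_tests n) hc using 1
  simp [funext_iff]

theorem abs_sub_le_traceDist_of_mem_tests (hf : f ∈ tests n) (M N : Program) :
    |f M - f N| ≤ traceDist M N := by
  let evalAt (P : Program) : (Program → ℝ) →ₗ[ℝ] ℝ := LinearMap.proj P
  let difference := evalAt M - evalAt N
  suffices h : tests n ⊆ difference ⁻¹' Metric.closedBall 0 (traceDist M N) by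
    simpa [difference, evalAt] using h hf
  refine tests_subset ((convex_closedBall _ _).linear_preimage _) ?_ ?_ fun s _ => ?_
  · simpa using traceDist_nonneg M N
  · simpa [difference, evalAt] using traceDist_nonneg M N
  · simpa [difference, evalAt] using abs_prob_sub_prob_le_traceDist M N s

theorem sum_smul_mem_of_convex_of_sum_le_one {𝕜 E ι : Type*} [Field 𝕜] [LinearOrder 𝕜]
    [IsStrictOrderedRing 𝕜] [AddCommGroup E] [Module 𝕜 E] {S : Set E} (hS : Convex 𝕜 S)
    (h0 : (0 : E) ∈ S) {t : Finset ι} {w : ι → 𝕜} {x : ι → E} (hw : ∀ i ∈ t, 0 ≤ w i)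
    (hw1 : ∑ i ∈ t, w i ≤ 1) (hx : ∀ i ∈ t, x i ∈ S) : ∑ i ∈ t, w i • x i ∈ S := by
  rcases (Finset.sum_nonneg hw).eq_or_lt with hsum | hsum
  · have hw0 := (Finset.sum_eq_zero_iff_of_nonneg hw).1 hsum.symm
    rwa [Finset.sum_eq_zero fun i hi => by rw [hw0 i hi, zero_smul]]
  · have h := hS.smul_mem_of_zero_mem h0 (hS.centerMass_mem hw hsum hx) ⟨hsum.le, hw1⟩
    rwa [Finset.centerMass, smul_inv_smul₀ hsum.ne'] at h

theorem expect_mem_tests (L : Program) {f : Value → Program → ℝ}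
    (hf : ∀ V ∈ (sem L).support, f V ∈ tests n) :
    (fun M => expect (fun V => f V M) L) ∈ tests n := by
  have hL := (sem_spec L).subdistribution
  convert sum_smul_mem_of_convex_of_sum_le_one (convex_tests n) (zero_mem_tests n)
    (fun V _ => hL.1 V) hL.2 hf using 1
  simp [funext_iff, expect_apply]

theorem expect_comp_mem_tests (hf : f ∈ tests m) {F : Program → Program}
    (hF : ∀ t : Trace, t.size ≤ m → (fun M => prob (F M) t) ∈ tests n) :
    (fun M => expect (fun V => f V.toProgram) (F M)) ∈ tests n := by
  let T : (Program → ℝ) →ₗ[ℝ] (Program → ℝ) :=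
    LinearMap.funLeft ℝ ℝ F ∘ₗ expect ∘ₗ LinearMap.funLeft ℝ ℝ Value.toProgram
  have hT : ∀ t : Trace, t.size ≤ m → T (fun M => prob M t) ∈ tests n := fun t ht => by
    convert hF t ht using 1
    exact funext fun M => (prob_eq_expect (F M) t).symm
  refine tests_subset (S := T ⁻¹' tests n) ((convex_tests n).linear_preimage T) ?_ ?_ hT hf
  · simpa using zero_mem_tests n
  -- `T 1` is not `1`: it is the probability that `F M` converges, which the empty trace observes.
  · have hT1 : T 1 = T fun M => prob M [] := by
      simp [T, LinearMap.funLeft, Function.comp_def, prob_value_nil, Pi.one_def]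
    exact Set.mem_preimage.2 (hT1 ▸ hT [] (Nat.zero_le m))

theorem prob_toProgram_mem_tests {K : Program → Value}
    (hK : ∀ V t, s = V :: t → (fun M => prob ((K M).apply V) t) ∈ tests n) :
    (fun M => prob (K M).toProgram s) ∈ tests n := by
  cases s with
  | nil =>
    simp only [prob_value_nil]
    exact one_mem_tests n
  | cons V t =>
    simp only [prob_value_cons]
    exact hK V t rfl

theorem prob_choice_mem_tests {F G : Program → Program} (hF : (fun M => prob (F M) s) ∈ tests n)
    (hG : (fun M => prob (G M) s) ∈ tests n) :
    (fun M => prob ((F M).choice (G M)) s) ∈ tests n := by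
  simp only [prob_choice]
  exact convex_tests n hF hG (by norm_num) (by norm_num) (by norm_num)

theorem prob_app_left_mem_tests {F : Program → Program} {L : Program}
    (hF : ∀ V ∈ (sem L).support, (fun M => prob (F M) (V :: s)) ∈ tests n) :
    (fun M => prob ((F M).app L) s) ∈ tests n := by
  simp only [prob_app_eq_expect_cons]
  exact expect_mem_tests L hF

theorem prob_app_right_mem_tests {F : Program → Program} {L : Program}
    (hL : ∀ U ∈ (sem L).support, ∃ f ∈ tests m, ∀ V, f V.toProgram = prob (U.apply V) s)
    (hF : ∀ t : Trace, t.size ≤ m → (fun M => prob (F M) t) ∈ tests n) :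
    (fun M => prob (L.app (F M)) s) ∈ tests n := by
  simp only [prob_app]
  refine expect_mem_tests L fun U hU => ?_
  obtain ⟨f, hf, hfU⟩ := hL U hU
  simpa only [hfU] using expect_comp_mem_tests hf hF

end Tests

section Substitution

variable {Γ : Finset ℕ} {M : Term} {k : ℕ}

theorem Term.Affine.subst_congr (h : M.Affine Γ) (hk : k ∉ Γ) (V W : Term) :
    Term.subst V k M = Term.subst W k M := by
  induction h generalizing k with
  | var hn => simp only [Term.subst, ne_of_mem_of_not_mem hn hk, if_false]
  | lam _ ih => simp only [Term.subst, ih (k := k + 1) (by simpa using hk)]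
  | app _ _ _ ihM ihN =>
    rw [Finset.notMem_union] at hk
    simp only [Term.subst, ihM hk.1, ihN hk.2]
  | choice _ _ ihM ihN => simp only [Term.subst, ihM hk, ihN hk]
  | omega => rfl

theorem Term.Affine.subst_eq_self (h : M.Affine Γ) (hk : ∀ n ∈ Γ, n < k) (V : Term) :
    Term.subst V k M = M := by
  induction h generalizing k with
  | var hn => simp only [Term.subst, (hk _ hn).ne, (hk _ hn).not_gt, if_false]
  | lam _ ih => rw [Term.subst, ih (by simpa using hk)]
  | app _ _ _ ihM ihN =>
    rw [Term.subst, ihM fun n hn => hk n (Finset.mem_union_left _ hn),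
      ihN fun n hn => hk n (Finset.mem_union_right _ hn)]
  | choice _ _ ihM ihN => rw [Term.subst, ihM hk, ihN hk]
  | omega => rfl

theorem Term.Affine.exists_fill_eq_subst (h : M.Affine Γ) (k : ℕ) :
    ∃ C : RawCtx, ∀ P, C.fill P = Term.subst P k M := by
  induction h generalizing k with
  | @var _ n _ =>
    by_cases hn : n = k
    · exact ⟨.hole, fun P => by simp only [RawCtx.fill, Term.subst, hn, if_true]⟩
    · exact ⟨.term (Term.subst .omega k (.var n)), fun P => by
        simp only [RawCtx.fill, Term.subst, hn, if_false]⟩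
  | lam _ ih =>
    obtain ⟨C, hC⟩ := ih (k + 1)
    exact ⟨.lam C, fun P => by rw [RawCtx.fill, hC, Term.subst]⟩
  | @app Γ Δ M N hd hM hN ihM ihN =>
    by_cases hk : k ∈ Γ
    · obtain ⟨C, hC⟩ := ihM k
      exact ⟨.appLeft C (Term.subst .omega k N), fun P => by
        rw [RawCtx.fill, hC, Term.subst, hN.subst_congr (Finset.disjoint_left.1 hd hk) P]⟩
    · obtain ⟨C, hC⟩ := ihN k
      exact ⟨.appRight (Term.subst .omega k M) C, fun P => by
        rw [RawCtx.fill, hC, Term.subst, hM.subst_congr hk P]⟩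
  | choice _ _ ihM ihN =>
    obtain ⟨C, hC⟩ := ihM k
    obtain ⟨C', hC'⟩ := ihN k
    exact ⟨.choice C C', fun P => by rw [RawCtx.fill, hC, hC', Term.subst]⟩
  | omega => exact ⟨.term .omega, fun _ => rfl⟩

end Substitution

namespace RawCtx

theorem Affine.of_fill {Γ : Finset ℕ} {C : RawCtx} {P : Term} (h : (C.fill P).Affine Γ) :
    C.Affine Γ := by
  induction C generalizing Γ with
  | hole => exact .hole
  | term M => exact .term h
  | lam C ih => cases h with | lam h => exact .lam (ih h)
  | appLeft C M ih => cases h with | app hd hC hM => exact RawCtx.Affine.appLeft hd (ih hC) hM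
  | appRight M C ih => cases h with | app hd hM hC => exact RawCtx.Affine.appRight hd hM (ih hC)
  | choice C C' ih ih' => cases h with | choice hC hC' => exact .choice (ih hC) (ih' hC')

theorem Affine.of_lam {Γ : Finset ℕ} {C : RawCtx} (h : (RawCtx.lam C).Affine Γ) :
    C.Affine (insert 0 (Γ.image Nat.succ)) := by
  cases h with | lam h => exact h

theorem Affine.of_choice {Γ : Finset ℕ} {C C' : RawCtx} (h : (RawCtx.choice C C').Affine Γ) :
    C.Affine Γ ∧ C'.Affine Γ := by
  cases h with | choice hC hC' => exact ⟨hC, hC'⟩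

theorem Affine.of_appLeft {C : RawCtx} {M : Term} (h : (RawCtx.appLeft C M).Affine ∅) :
    C.Affine ∅ ∧ M.Affine ∅ := by
  generalize hΓ : (∅ : Finset ℕ) = Γ at h
  cases h with
  | appLeft _ hC hM =>
    obtain ⟨rfl, rfl⟩ := Finset.union_eq_empty.1 hΓ.symm
    exact ⟨hC, hM⟩

theorem Affine.of_appRight {C : RawCtx} {M : Term} (h : (RawCtx.appRight M C).Affine ∅) :
    M.Affine ∅ ∧ C.Affine ∅ := by
  generalize hΓ : (∅ : Finset ℕ) = Γ at h
  cases h with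
  | appRight _ hM hC =>
    obtain ⟨rfl, rfl⟩ := Finset.union_eq_empty.1 hΓ.symm
    exact ⟨hM, hC⟩

/-- The size of a context, whose hole counts as the term `Ω` of size one. -/
def size (C : RawCtx) : ℕ := (C.fill .omega).size

/-- Substitution of the closed term `V` for the variable `k` of a context. The hole is left alone,
as it stands for a closed term. -/
def subst (V : Term) : ℕ → RawCtx → RawCtx
  | _, .hole => .hole
  | k, .term M => .term (Term.subst V k M)
  | k, .lam C => .lam (subst V (k + 1) C)
  | k, .appLeft C M => .appLeft (subst V k C) (Term.subst V k M)
  | k, .appRight M C => .appRight (Term.subst V k M) (subst V k C)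
  | k, .choice C C' => .choice (subst V k C) (subst V k C')

theorem fill_subst (C : RawCtx) (V : Term) (k : ℕ) {P : Term} (hP : P.Affine ∅) :
    (C.subst V k).fill P = Term.subst V k (C.fill P) := by
  induction C generalizing k with
  | hole => exact (hP.subst_eq_self (by simp) V).symm
  | term M => rfl
  | lam C ih => simp only [subst, fill, Term.subst, ih]
  | appLeft C M ih => simp only [subst, fill, Term.subst, ih]
  | appRight M C ih => simp only [subst, fill, Term.subst, ih]
  | choice C C' ih ih' => simp only [subst, fill, Term.subst, ih, ih']

theorem Affine.exists_fill_eq_apply {C : RawCtx} (hC : C.Affine {0}) (V : Value) :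
    ∃ D : Ctx, D.1.size ≤ C.size + V.toProgram.1.size ∧
      ∀ M : Program, D.fill M = Value.apply ⟨C.fill M.1, hC.fill M.2⟩ V := by
  have hsubst : (C.subst V.toProgram.1 0).fill .omega = _ := C.fill_subst _ 0 .omega
  have hΩ : (C.fill .omega).Affine {0} := hC.fill .omega
  refine ⟨⟨C.subst V.toProgram.1 0, .of_fill (P := .omega) ?_⟩, ?_,
    fun M => Subtype.ext (C.fill_subst _ 0 M.2)⟩
  · simpa [hsubst] using hΩ.subst V.toProgram.2 0
  · simpa [size, hsubst] using hΩ.size_subst V.toProgram.1 0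

end RawCtx

theorem Value.exists_fill_eq_apply (U : Value) :
    ∃ D : Ctx, D.1.size ≤ U.toProgram.1.size ∧
      ∀ V : Value, D.fill V.toProgram = U.apply V := by
  obtain ⟨C, hC⟩ := U.affine.exists_fill_eq_subst 0
  refine ⟨⟨C, .of_fill (P := .omega) ?_⟩, ?_, fun V => Subtype.ext (hC V.toProgram.1)⟩
  · simpa [hC] using U.affine.subst .omega 0
  · simpa [RawCtx.size, hC, Value.toProgram, Term.size] using U.affine.size_subst .omega 0

theorem prob_fill_mem_tests {C : RawCtx} (hC : C.Affine ∅) (s : Trace) :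
    (fun M => prob (Ctx.fill ⟨C, hC⟩ M) s) ∈ tests (C.size + s.size) := by
  induction hn : C.size + s.size using Nat.strong_induction_on generalizing C s with
  | _ n ih =>
  subst hn
  replace ih (D : RawCtx) (hD : D.Affine ∅) (t : Trace) (h : D.size + t.size < C.size + s.size) :
      (fun M => prob (Ctx.fill ⟨D, hD⟩ M) t) ∈ tests (D.size + t.size) := ih _ h hD t rfl
  have ih' (D : RawCtx) (hD : D.Affine ∅) (t : Trace) (h : D.size + t.size < C.size + s.size) :
      (fun M => prob (Ctx.fill ⟨D, hD⟩ M) t) ∈ tests (C.size + s.size) :=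
    tests_mono h.le (ih D hD t h)
  cases C with
  | hole => exact prob_mem_tests (Nat.le_add_left _ _)
  | term L => exact const_mem_tests (prob_mem_Icc ⟨L, hC.fill (P := .omega) .omega⟩ s)
  | lam C =>
    have hsize : (RawCtx.lam C).size = C.size + 1 := rfl
    have hC' : C.Affine {0} := by simpa using hC.of_lam
    refine prob_toProgram_mem_tests (K := fun M => ⟨C.fill M.1, hC'.fill M.2⟩) ?_
    rintro V t rfl
    obtain ⟨D, hDsize, hDfill⟩ := hC'.exists_fill_eq_apply V
    simp only [← hDfill]
    exact ih' D.1 D.2 t (by rw [Trace.size_cons]; omega)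
  | appLeft C L =>
    have hsize : (RawCtx.appLeft C L).size = C.size + L.size + 1 := rfl
    obtain ⟨hC, hL⟩ := hC.of_appLeft
    refine prob_app_left_mem_tests (F := Ctx.fill ⟨C, hC⟩) (L := ⟨L, hL⟩) fun V hV => ?_
    have hVsize : V.toProgram.1.size ≤ L.size := size_le_of_mem_support_sem hV
    exact ih' C hC (V :: s) (by rw [Trace.size_cons]; omega)
  | appRight L C =>
    have hsize : (RawCtx.appRight L C).size = L.size + C.size + 1 := rfl
    obtain ⟨hL, hC⟩ := hC.of_appRight
    refine prob_app_right_mem_tests (m := L.size + s.size) (F := Ctx.fill ⟨C, hC⟩) (L := ⟨L, hL⟩)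
      (fun U hU => ?_) fun t ht => ih' C hC t (by omega)
    have hUsize : U.toProgram.1.size ≤ L.size := size_le_of_mem_support_sem hU
    obtain ⟨D, hDsize, hDfill⟩ := U.exists_fill_eq_apply
    exact ⟨_, tests_mono (by omega) (ih D.1 D.2 s (by omega)), fun V => by rw [hDfill]⟩
  | choice C C' =>
    have hsize : (RawCtx.choice C C').size = max C.size C'.size + 1 := rfl
    obtain ⟨hC, hC'⟩ := hC.of_choice
    exact prob_choice_mem_tests (ih' C hC s (by omega)) (ih' C' hC' s (by omega))

end AffineLambda

theorem mainTheorem1 (M N : AffineLambda.Program) (C : AffineLambda.Ctx) :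
    AffineLambda.traceDist (C.fill M) (C.fill N) ≤ AffineLambda.traceDist M N :=
  ciSup_le fun s =>
    AffineLambda.abs_sub_le_traceDist_of_mem_tests (AffineLambda.prob_fill_mem_tests C.2 s) M N
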